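/- Let $a,b,c\in\mathbb{R}$ and $\lambda>0$, and let $(X_n)_{n\ge 0}$ be the Markov chain on $\mathbb{N}^3$ which from a state $(i,j,k)$ moves to $(\ell,i,j)$, where $\ell$ is a Poisson random variable with parameter $\max(0,\,ai+bj+ck+\lambda)$. (This is the chain $X_n=(\tilde X_n,\tilde X_{n-1},\tilde X_{n-2})$ associated with the discrete-time Hawkes process $\tilde X_n\sim\mathcal{P}\big((a\tilde X_{n-1}+b\tilde X_{n-2}+c\tilde X_{n-3}+\lambda)_+\big)$ with memory $3$.) Suppose that $b<0$, $c<0$ and that the discriminant of the polynomial $X^3-aX^2-bX-c$ is negative, that is, $$a^2b^2+4b^3-4a^3c-18abc-27c^2<0 .$$ Then $(X_n)_{n\ge 0}$ is geometrically ergodic: there are a stationary distribution $\pi$ of the chain and a number $\rho\in(0,1)$ such that for every initial state $x\in\mathbb{N}^3$ there is a constant $C_x<\infty$ with $$\|P^n(x,\cdot)-\pi\|_{TV}\le C_x\,\rho^n\qquad\text{for all } n\ge 0,$$ where $P^n(x,\cdot)$ is the law of $X_n$ when $X_0=x$ and $\|\mu-\nu\|_{TV}=\sup_{A\subset\mathbb{N}^3}|\mu(A)-\nu(A)|$.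 -/

import Mathlib

open MeasureTheory ProbabilityTheory

noncomputable section

/-- The Poisson intensity `(a * i + b * j + c * k + lam)₊` of the next value when the last three
values of the process are `i` (the most recent one), `j` and `k`. -/
def hawkesIntensity (a b c lam : ℝ) (x : ℕ × ℕ × ℕ) : NNReal :=
  Real.toNNReal (a * (x.1 : ℝ) + b * (x.2.1 : ℝ) + c * (x.2.2 : ℝ) + lam)

/-- The transition kernel on `ℕ³` of the chain `X_n`, the triple of the last three values of the
discrete-time Hawkes process with memory `3`: from `(i, j, k)` it moves to `(l, i, j)`,
where `l` is a Poisson variable of parameter `(a * i + b * j + c * k + lam)₊`. -/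
def hawkesKernel (a b c lam : ℝ) : Kernel (ℕ × ℕ × ℕ) (ℕ × ℕ × ℕ) :=
  Kernel.ofFunOfCountable fun x =>
    (poissonMeasure (hawkesIntensity a b c lam x)).map (fun l : ℕ => (l, x.1, x.2.1))

/-- The total variation distance `sup_A |μ(A) - ν(A)|`, over all measurable sets `A`, between two
probability measures (the supremum is then that of a family bounded by `1`). -/
def tvDist {S : Type*} [MeasurableSpace S] (μ ν : Measure S) : ℝ :=
  ⨆ A : {A : Set S // MeasurableSet A}, |μ.real A.1 - ν.real A.1|

/-- A Markov chain with transition kernel `κ` is geometrically ergodic: it has a stationary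
distribution `μ`, and from every initial state `x` the law `κ ^ n` (at `x`) of the chain at time `n`
converges to `μ` exponentially fast in total variation. The rate `ρ` does not depend on the
initial state; the constant `C` may. Here `κ ^ n` is the `n`-fold composition of `κ`. -/
def IsGeometricallyErgodic {S : Type*} [MeasurableSpace S] (κ : Kernel S S) : Prop :=
  ∃ μ : Measure S, IsProbabilityMeasure μ ∧ κ.Invariant μ ∧
    ∃ ρ : ℝ, 0 < ρ ∧ ρ < 1 ∧ ∀ x : S, ∃ C : ℝ, ∀ n : ℕ, tvDist ((κ ^ n) x) μ ≤ C * ρ ^ n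

/-- The kernel is a Markov kernel. -/
instance hawkesKernel_isMarkovKernel (a b c lam : ℝ) : IsMarkovKernel (hawkesKernel a b c lam) where
  isProbabilityMeasure x := by
    change IsProbabilityMeasure
      ((poissonMeasure (hawkesIntensity a b c lam x)).map (fun l : ℕ => (l, x.1, x.2.1)))
    exact Measure.isProbabilityMeasure_map (Measurable.of_discrete).aemeasurable

end

/-!
The chain is compared with its deterministic skeleton, the positively homogeneous map
`D (i, j, k) = ((a i + b j + c k)₊, i, j)` on the nonnegative cone of `ℝ³`.

*The skeleton is nilpotent.* Since `c < 0` and the discriminant is negative, the polynomial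
`X³ - a X² - b X - c` has one negative root `-d` and two non-real roots. As long as an orbit
`z n` of the skeleton stays positive, it solves the linear recursion, and `z (n + 1) + d * z n` is a
positive solution of a linear recursion of order two with non-real characteristic roots. The
ratios of consecutive terms of such a solution decrease by a fixed amount at each step, so that it
has bounded length (`exists_length_positive_solution`). Once `z n = 0`, the signs of `b` and `c`
keep all later values at zero. Hence a power `D^N` vanishes on the whole cone
(`exists_iterate_hawkesFlow_eq_zero`).

*Drift.* With this `N`, the function `V x = ∑ j < N, 4 ^ j * ‖D^j x‖₁` satisfies
`V (D x) ≤ V x / 4`. It is Lipschitz, and the next state differs from `D x` by at most `lam` and the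
deviation of a Poisson variable of parameter `O(‖x‖₁ + 1)` from its mean, which is of the order of
the square root of the parameter. So the expectation of `V` after one step is at most `V x / 2 + K`
(`exists_drift`).

*Ergodicity.* Three successive zeros lead to the origin, with probability bounded below on each
sublevel set of `V`. Harris' theorem (`isGeometricallyErgodic_of_drift`), proved here through
the contraction of weighted oscillations of Hairer and Mattingly
(`abs_integral_sub_integral_le`), then yields geometric ergodicity.
-/

open Filter Topology

/-! ### Contraction of weighted oscillations -/

/-- If `f x - f y ≤ w x + w y` everywhere, then `f` is within `w` of some constant. -/
lemma exists_const_abs_sub_le {S : Type*} [Nonempty S] {f w : S → ℝ}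
    (h : ∀ x y, f x - f y ≤ w x + w y) : ∃ c, ∀ x, |f x - c| ≤ w x := by
  obtain ⟨o⟩ := ‹Nonempty S›
  have hbdd : BddAbove (Set.range fun x => f x - w x) :=
    ⟨f o + w o, by rintro _ ⟨x, rfl⟩; simp only; linarith [h x o]⟩
  refine ⟨⨆ x, (f x - w x), fun x => abs_le.2 ⟨?_, ?_⟩⟩
  · have : ⨆ x, (f x - w x) ≤ f x + w x := ciSup_le fun y => by linarith [h y x]
    linarith
  · linarith [le_ciSup hbdd x]

lemma mul_le_integral_of_le_singleton {S : Type*} [MeasurableSpace S] [MeasurableSingletonClass S]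
    {μ : Measure S} [IsFiniteMeasure μ] {f : S → ℝ} (hf : Integrable f μ) (hf0 : ∀ x, 0 ≤ f x)
    {α : ℝ} {z : S} (hα : α ≤ μ.real {z}) : α * f z ≤ ∫ x, f x ∂μ := by
  calc α * f z ≤ μ.real {z} * f z := mul_le_mul_of_nonneg_right hα (hf0 z)
    _ = ∫ x in {z}, f x ∂μ := by rw [integral_singleton, smul_eq_mul]
    _ ≤ ∫ x, f x ∂μ := setIntegral_le_integral hf (ae_of_all _ hf0)

/-- One step of the Markov operator contracts weighted oscillations. If
`|φ x - φ y| ≤ A * (2 + β * (V x + V y))`, then the averages of `φ` against the kernel satisfy the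
same bound with `A` replaced by `θ * A`. Where `V x + V y` is large this is the drift of `V`
alone; elsewhere the mass `α` that both transition laws put on `z` cancels. -/
lemma abs_integral_sub_integral_le {S : Type*} [MeasurableSpace S] [MeasurableSingletonClass S]
    {η : Kernel S S} [IsMarkovKernel η] {V : S → ℝ} (hV0 : ∀ x, 0 ≤ V x)
    {γ K α β R θ : ℝ} (hβ : 0 ≤ β) (hα0 : 0 ≤ α)
    (hint : ∀ x, Integrable V (η x)) (hdrift : ∀ x, ∫ y, V y ∂η x ≤ γ * V x + K)
    {z : S} (hα : ∀ x, V x ≤ R → α ≤ (η x).real {z})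
    (hlarge : ∀ s, R ≤ s → 2 + β * (γ * s + 2 * K) ≤ θ * (2 + β * s))
    (hsmall : ∀ s, 0 ≤ s → 2 * (1 - α) + β * (γ * s + 2 * K) ≤ θ * (2 + β * s))
    {φ : S → ℝ} (hφ : Measurable φ) {A : ℝ} (hA : 0 ≤ A)
    (hosc : ∀ x y, |φ x - φ y| ≤ A * (2 + β * (V x + V y))) (x y : S) :
    |∫ u, φ u ∂η x - ∫ u, φ u ∂η y| ≤ θ * A * (2 + β * (V x + V y)) := by
  have : Nonempty S := ⟨z⟩
  set W : S → ℝ := fun x => A * (1 + β * V x) with hW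
  have hW0 : ∀ x, 0 ≤ W x := fun x => by have := hV0 x; simp only [hW]; positivity
  obtain ⟨c, hc⟩ : ∃ c, ∀ x, |φ x - c| ≤ W x := exists_const_abs_sub_le fun x y => by
    refine (le_abs_self _).trans ((hosc x y).trans (le_of_eq ?_))
    simp only [hW]; ring
  have hWint : ∀ x, Integrable W (η x) := fun x =>
    ((integrable_const 1).add ((hint x).const_mul β)).const_mul A
  have hWI : ∀ x, ∫ u, W u ∂η x ≤ A * (1 + β * (γ * V x + K)) := fun x => by
    simp only [hW]
    rw [integral_const_mul, integral_add (integrable_const _) ((hint x).const_mul β),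
      integral_const_mul]
    simp only [integral_const, probReal_univ, smul_eq_mul, one_mul]
    have := hdrift x
    gcongr
  have hψint : ∀ x, Integrable (fun u => φ u - c) (η x) := fun x =>
    (hWint x).mono' (hφ.sub_const c).aestronglyMeasurable (ae_of_all _ fun u => hc u)
  have hφint : ∀ x, Integrable φ (η x) := fun x => by
    exact ((hψint x).add (integrable_const c)).congr (ae_of_all _ fun u => by simp)
  have hshift : ∀ x, ∫ u, φ u ∂η x = ∫ u, (φ u - c) ∂η x + c := fun x => by
    rw [integral_sub (hφint x) (integrable_const c)]; simp
  rw [hshift x, hshift y, add_sub_add_right_eq_sub]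
  rcases le_total R (V x + V y) with hR | hR
  · have key : ∀ x, |∫ u, (φ u - c) ∂η x| ≤ ∫ u, W u ∂η x := fun x => by
      refine (abs_integral_le_integral_abs).trans ?_
      exact integral_mono (hψint x).abs (hWint x) hc
    calc _ ≤ |∫ u, (φ u - c) ∂η x| + |∫ u, (φ u - c) ∂η y| := abs_sub _ _
      _ ≤ A * (1 + β * (γ * V x + K)) + A * (1 + β * (γ * V y + K)) :=
        add_le_add ((key x).trans (hWI x)) ((key y).trans (hWI y))
      _ = A * (2 + β * (γ * (V x + V y) + 2 * K)) := by ring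
      _ ≤ A * (θ * (2 + β * (V x + V y))) := by gcongr; exact hlarge _ hR
      _ = _ := by ring
  · have key : ∀ x, V x ≤ R →
        |∫ u, (φ u - c) ∂η x - α * (φ z - c)| ≤ ∫ u, W u ∂η x - α * W z := fun x hx => by
      have h1 := mul_le_integral_of_le_singleton ((hWint x).sub (hψint x))
        (fun u => sub_nonneg.2 (le_of_abs_le (hc u))) (hα x hx)
      have h2 := mul_le_integral_of_le_singleton ((hWint x).add (hψint x))
        (fun u => by have := neg_le_of_abs_le (hc u); simp only [Pi.add_apply]; linarith) (hα x hx)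
      simp only [Pi.sub_apply, Pi.add_apply] at h1 h2
      rw [integral_sub (hWint x) (hψint x)] at h1
      rw [integral_add (hWint x) (hψint x)] at h2
      rw [abs_le]
      constructor <;> nlinarith
    have hx := key x (by linarith [hV0 y])
    have hy := key y (by linarith [hV0 x])
    have hz : α * A ≤ α * W z := by
      have := hV0 z
      simp only [hW]
      refine mul_le_mul_of_nonneg_left (le_mul_of_one_le_right hA ?_) hα0
      have : 0 ≤ β * V z := by positivity
      linarith
    calc _ = |(∫ u, (φ u - c) ∂η x - α * (φ z - c)) - (∫ u, (φ u - c) ∂η y - α * (φ z - c))| := by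
          congr 1; ring
      _ ≤ |∫ u, (φ u - c) ∂η x - α * (φ z - c)| + |∫ u, (φ u - c) ∂η y - α * (φ z - c)| :=
        abs_sub _ _
      _ ≤ A * (1 + β * (γ * V x + K)) - α * A + (A * (1 + β * (γ * V y + K)) - α * A) :=
        add_le_add (hx.trans (by linarith [hWI x])) (hy.trans (by linarith [hWI y]))
      _ = A * (2 * (1 - α) + β * (γ * (V x + V y) + 2 * K)) := by ring
      _ ≤ A * (θ * (2 + β * (V x + V y))) := by
        gcongr; exact hsmall _ (add_nonneg (hV0 x) (hV0 y))
      _ = _ := by ring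

/-- The weight `β` and the rate `θ` of the contraction. The choice `2 * β * K = α` lets the
overlap `α` absorb the constant of the drift on sublevel sets, while `4 * K ≤ (1 - γ) * R` lets the
drift itself absorb it beyond them. -/
lemma exists_contraction_constants {γ K α R : ℝ} (hγ0 : 0 ≤ γ) (hγ : γ < 1) (hK : 0 < K)
    (hR : 4 * K ≤ (1 - γ) * R) (hα : 0 < α) :
    ∃ β θ : ℝ, 0 < β ∧ 0 < θ ∧ θ < 1 ∧
      (∀ s, R ≤ s → 2 + β * (γ * s + 2 * K) ≤ θ * (2 + β * s)) ∧
      (∀ s, 0 ≤ s → 2 * (1 - α) + β * (γ * s + 2 * K) ≤ θ * (2 + β * s)) := by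
  obtain ⟨β, hβ⟩ : ∃ β, β = α / (2 * K) := ⟨_, rfl⟩
  have hβ0 : 0 < β := by rw [hβ]; positivity
  have hβK : 2 * (β * K) = α := by rw [hβ]; field_simp
  have hR0 : 0 < R := by
    by_contra! h
    nlinarith
  have hγ1 : 0 < 1 - γ := by linarith
  have hpos : 0 < (1 - γ) * β * R / 8 := by positivity
  refine ⟨β, max ((3 + γ) / 4) (max (1 - (1 - γ) * β * R / 8) (1 - α / 2)), hβ0,
    lt_max_of_lt_left (by linarith),
    max_lt (by linarith) (max_lt (by linarith) (by linarith)), fun s hs => ?_, fun s hs => ?_⟩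
  all_goals
    set θ := max ((3 + γ) / 4) (max (1 - (1 - γ) * β * R / 8) (1 - α / 2))
    have h1 : (3 + γ) / 4 ≤ θ := le_max_left _ _
    have h2 : 1 - (1 - γ) * β * R / 8 ≤ θ := (le_max_left _ _).trans (le_max_right _ _)
    have h3 : 1 - α / 2 ≤ θ := (le_max_right _ _).trans (le_max_right _ _)
  · have e1 : β * (4 * K) ≤ β * ((1 - γ) * s) := by
      exact mul_le_mul_of_nonneg_left (hR.trans (by gcongr)) hβ0.le
    have e2 : (3 + γ) / 4 * (β * s) ≤ θ * (β * s) := by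
      have : 0 ≤ s := hR0.le.trans hs
      gcongr
    have e3 : (1 - γ) * β * R ≤ (1 - γ) * β * s := by gcongr
    nlinarith
  · have e2 : (3 + γ) / 4 * (β * s) ≤ θ * (β * s) := by gcongr
    have e3 : 0 ≤ (1 - γ) * (β * s) := by positivity
    nlinarith

/-! ### Convergence in total variation -/

/-- A sequence of probability measures that is uniformly Cauchy on measurable sets at a geometric
rate converges to a probability measure at that rate. -/
lemma exists_measure_of_geometric {S : Type*} [MeasurableSpace S] (p : ℕ → Measure S)
    [∀ n, IsProbabilityMeasure (p n)] {C r : ℝ} (hr0 : 0 ≤ r) (hr : r < 1)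
    (hp : ∀ n A, MeasurableSet A → |(p n).real A - (p (n + 1)).real A| ≤ C * r ^ n) :
    ∃ μ : Measure S, IsProbabilityMeasure μ ∧
      ∀ n A, MeasurableSet A → |(p n).real A - μ.real A| ≤ C * r ^ n / (1 - r) := by
  have hlim : ∀ A, MeasurableSet A → ∃ a, Tendsto (fun n => (p n).real A) atTop (𝓝 a) := by
    intro A hA
    exact cauchySeq_tendsto_of_complete (cauchySeq_of_le_geometric r C hr fun n => hp n A hA)
  choose! m hm using hlim
  have hbound : ∀ n A, MeasurableSet A → |(p n).real A - m A| ≤ C * r ^ n / (1 - r) := fun n A hA =>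
    dist_le_of_le_geometric_of_tendsto r C hr (fun n => hp n A hA) (hm A hA) n
  have herr : Tendsto (fun n => C * r ^ n / (1 - r)) atTop (𝓝 0) := by
    simpa using ((tendsto_pow_atTop_nhds_zero_of_lt_one hr0 hr).const_mul C).div_const (1 - r)
  have hm0 : ∀ A, MeasurableSet A → 0 ≤ m A := fun A hA =>
    ge_of_tendsto' (hm A hA) fun n => measureReal_nonneg
  have hempty : m ∅ = 0 := tendsto_nhds_unique (hm ∅ .empty) (by simp)
  -- Uniformity of the convergence lets the limits over `n` and over partial unions be exchanged.
  have hsum : ∀ f : ℕ → Set S, (∀ i, MeasurableSet (f i)) → Pairwise (Function.onFun Disjoint f) →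
      HasSum (fun i => m (f i)) (m (⋃ i, f i)) := by
    intro f hf hd
    have hfin : ∀ k, m (⋃ i ∈ Finset.range k, f i) = ∑ i ∈ Finset.range k, m (f i) := fun k => by
      have h1 := hm (⋃ i ∈ Finset.range k, f i) (.biUnion (Finset.countable_toSet _) fun i _ => hf i)
      refine tendsto_nhds_unique h1 ?_
      have h2 : Tendsto (fun n => ∑ i ∈ Finset.range k, (p n).real (f i)) atTop
          (𝓝 (∑ i ∈ Finset.range k, m (f i))) := tendsto_finsetSum _ fun i _ => hm _ (hf i)
      refine h2.congr fun n => ?_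
      rw [measureReal_biUnion_finset (fun i _ j _ hij => hd hij) fun i _ => hf i]
    rw [hasSum_iff_tendsto_nat_of_nonneg fun i => hm0 _ (hf i)]
    have hU : MeasurableSet (⋃ i, f i) := .iUnion hf
    have hunif : TendstoUniformly (fun n k => (p n).real (⋃ i ∈ Finset.range k, f i))
        (fun k => m (⋃ i ∈ Finset.range k, f i)) atTop := by
      rw [Metric.tendstoUniformly_iff]
      intro ε hε
      filter_upwards [herr.eventually_lt_const hε] with n hn k
      rw [dist_comm]
      exact (hbound n _ (.biUnion (Finset.countable_toSet _) fun i _ => hf i)).trans_lt hn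
    have hk : ∀ n, Tendsto (fun k => (p n).real (⋃ i ∈ Finset.range k, f i)) atTop
        (𝓝 ((p n).real (⋃ i, f i))) := fun n => by
      have h := tendsto_measure_iUnion_atTop (μ := p n)
        (s := fun k => ⋃ i ∈ Finset.range k, f i) fun k l hkl =>
          Set.biUnion_subset_biUnion_left (Finset.range_subset_range.2 hkl)
      have hU' : ⋃ k, ⋃ i ∈ Finset.range k, f i = ⋃ i, f i := by
        ext a
        simp only [Set.mem_iUnion, Finset.mem_range]
        exact ⟨fun ⟨_, i, _, hi⟩ => ⟨i, hi⟩, fun ⟨i, hi⟩ => ⟨i + 1, i, i.lt_succ_self, hi⟩⟩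
      rw [hU'] at h
      exact (ENNReal.tendsto_toReal (measure_ne_top _ _)).comp h
    have := hunif.tendsto_of_eventually_tendsto (Eventually.of_forall hk) (hm _ hU)
    exact this.congr fun k => hfin k
  let μ : Measure S := Measure.ofMeasurable (fun A _ => ENNReal.ofReal (m A)) (by simp [hempty])
    (fun f hf hd => by
      rw [← (hsum f hf hd).tsum_eq, ENNReal.ofReal_tsum_of_nonneg (fun i => hm0 _ (hf i))
        (hsum f hf hd).summable])
  have hμ : ∀ A, MeasurableSet A → μ.real A = m A := fun A hA => by
    rw [measureReal_def, Measure.ofMeasurable_apply A hA, ENNReal.toReal_ofReal (hm0 A hA)]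
  refine ⟨μ, ⟨?_⟩, fun n A hA => by rw [hμ A hA]; exact hbound n A hA⟩
  rw [Measure.ofMeasurable_apply _ .univ,
    show m Set.univ = 1 from tendsto_nhds_unique (hm Set.univ .univ) (by simp), ENNReal.ofReal_one]

/-- A uniform bound on the difference of two measures on measurable sets also bounds the difference
of the integrals of a `[0, 1]`-valued function, by the layer-cake formula. -/
lemma abs_integral_sub_le_of_forall_abs_measureReal_sub_le {S : Type*} [MeasurableSpace S]
    {μ ν : Measure S} [IsFiniteMeasure μ] [IsFiniteMeasure ν] {ε : ℝ}
    (h : ∀ A, MeasurableSet A → |μ.real A - ν.real A| ≤ ε) {f : S → ℝ} (hf : Measurable f)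
    (hf0 : ∀ x, 0 ≤ f x) (hf1 : ∀ x, f x ≤ 1) : |∫ x, f x ∂μ - ∫ x, f x ∂ν| ≤ ε := by
  have hi : ∀ (μ : Measure S) [IsFiniteMeasure μ], Integrable f μ := fun μ _ =>
    Integrable.of_bound hf.aestronglyMeasurable 1
      (ae_of_all _ fun x => by rw [Real.norm_of_nonneg (hf0 x)]; exact hf1 x)
  have hanti : ∀ (μ : Measure S) [IsFiniteMeasure μ],
      IntegrableOn (fun t : ℝ => μ.real {a | t ≤ f a}) (Set.Ioc 0 1) := fun μ _ => by
    have ha : Antitone (fun t : ℝ => μ.real {a | t ≤ f a}) := fun s t hst =>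
      measureReal_mono fun a (ha : t ≤ f a) => hst.trans ha
    exact (ha.locallyIntegrable.integrableOn_isCompact isCompact_Icc).mono_set Set.Ioc_subset_Icc_self
  rw [(hi μ).integral_eq_integral_Ioc_meas_le (M := 1) (ae_of_all _ hf0) (ae_of_all _ hf1),
    (hi ν).integral_eq_integral_Ioc_meas_le (M := 1) (ae_of_all _ hf0) (ae_of_all _ hf1),
    ← integral_sub (hanti μ) (hanti ν)]
  have := norm_setIntegral_le_of_norm_le_const (μ := volume) (s := Set.Ioc (0 : ℝ) 1) (C := ε)
    (f := fun t : ℝ => μ.real {a | t ≤ f a} - ν.real {a | t ≤ f a}) (by simp)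
    (fun t _ => h _ (measurableSet_le measurable_const hf))
  simpa using this

/-! ### Harris' theorem for a chain with an atom -/

section Powers

variable {S : Type*} [MeasurableSpace S] {κ : Kernel S S}

instance ProbabilityTheory.Kernel.isMarkovKernel_pow [IsMarkovKernel κ] (n : ℕ) :
    IsMarkovKernel (κ ^ n) := by
  induction n with
  | zero => rw [pow_zero]; exact inferInstanceAs (IsMarkovKernel Kernel.id)
  | succ n ih => rw [pow_succ]; exact inferInstanceAs (IsMarkovKernel ((κ ^ n) ∘ₖ κ))

lemma ProbabilityTheory.Kernel.pow_add_real_eq_integral [IsMarkovKernel κ] (m n : ℕ) (x : S)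
    {A : Set S} (hA : MeasurableSet A) :
    ((κ ^ (m + n)) x).real A = ∫ y, ((κ ^ m) y).real A ∂((κ ^ n) x) := by
  rw [measureReal_def, add_comm, Kernel.pow_add_apply_eq_lintegral _ _ _ _ hA]
  exact (integral_toReal (Kernel.measurable_coe _ hA).aemeasurable
    (ae_of_all _ fun y => measure_lt_top ((κ ^ m) y) A)).symm

lemma ProbabilityTheory.Kernel.measurable_real (n : ℕ) {A : Set S} (hA : MeasurableSet A) :
    Measurable fun x => ((κ ^ n) x).real A :=
  (Kernel.measurable_coe _ hA).ennreal_toReal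

lemma ProbabilityTheory.Kernel.lintegral_pow_le [IsMarkovKernel κ] {V : S → NNReal}
    (hV : Measurable V) {γ K : NNReal} (hγ : γ ≤ 1)
    (hdrift : ∀ x, ∫⁻ y, V y ∂κ x ≤ γ * V x + K) (n : ℕ) (x : S) :
    ∫⁻ y, V y ∂(κ ^ n) x ≤ ↑(γ ^ n) * V x + ↑(n * K) := by
  induction n with
  | zero =>
    rw [pow_zero, pow_zero]
    change ∫⁻ y, V y ∂(Kernel.id x) ≤ _
    rw [Kernel.id_apply, lintegral_dirac' _ hV.coe_nnreal_ennreal]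
    simp
  | succ n ih =>
    rw [pow_succ']
    change ∫⁻ y, V y ∂((κ ∘ₖ (κ ^ n)) x) ≤ _
    rw [Kernel.lintegral_comp _ _ _ hV.coe_nnreal_ennreal]
    calc ∫⁻ y, ∫⁻ u, V u ∂κ y ∂(κ ^ n) x ≤ ∫⁻ y, (γ * V y + K) ∂(κ ^ n) x :=
          lintegral_mono hdrift
      _ = γ * ∫⁻ y, V y ∂(κ ^ n) x + K := by
          rw [lintegral_add_right _ measurable_const, lintegral_const_mul _ hV.coe_nnreal_ennreal]
          simp
      _ ≤ γ * (↑(γ ^ n) * V x + ↑(n * K)) + K := by gcongr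
      _ ≤ ↑(γ ^ (n + 1)) * V x + ↑((n + 1 : ℕ) * K) := by
          norm_cast
          push_cast
          have : γ * (n * K) ≤ 1 * (n * K) := by gcongr
          calc _ = γ ^ (n + 1) * V x + γ * (n * K) + K := by ring
            _ ≤ γ ^ (n + 1) * V x + 1 * (n * K) + K := by gcongr
            _ = _ := by ring

/-- A path bounds a transition probability from below. -/
lemma ProbabilityTheory.Kernel.mul_le_pow_succ_apply [MeasurableSingletonClass S] (n : ℕ)
    (x y z : S) :
    κ x {y} * (κ ^ n) y {z} ≤ (κ ^ (n + 1)) x {z} := by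
  rw [add_comm n 1, Kernel.pow_add_apply_eq_lintegral _ _ _ _ (measurableSet_singleton z), pow_one]
  calc κ x {y} * (κ ^ n) y {z} = ∫⁻ u in {y}, (κ ^ n) u {z} ∂κ x := by
        rw [lintegral_singleton, mul_comm]
    _ ≤ _ := setLIntegral_le_lintegral _ _

end Powers

/-- Iterated over blocks of `k` steps, a contraction of oscillations brings the laws started from
two points together. The induction starts from the probabilities of `A`, whose oscillation is at
most `1`. -/
lemma abs_pow_real_sub_le {S : Type*} [MeasurableSpace S] {κ : Kernel S S} [IsMarkovKernel κ]
    {k : ℕ} {w : S → S → ℝ} {θ : ℝ} (hθ : 0 ≤ θ) (hw : ∀ x y, 1 ≤ 2⁻¹ * w x y)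
    (hcontr : ∀ φ : S → ℝ, Measurable φ → ∀ A : ℝ, 0 ≤ A → (∀ x y, |φ x - φ y| ≤ A * w x y) →
      ∀ x y, |∫ u, φ u ∂(κ ^ k) x - ∫ u, φ u ∂(κ ^ k) y| ≤ θ * A * w x y)
    {A : Set S} (hA : MeasurableSet A) (q r : ℕ) (x y : S) :
    |((κ ^ (r + k * q)) x).real A - ((κ ^ (r + k * q)) y).real A| ≤ θ ^ q * 2⁻¹ * w x y := by
  induction q generalizing x y with
  | zero =>
    refine le_trans ?_ ((hw x y).trans (by simp))
    exact abs_sub_le_of_nonneg_of_le measureReal_nonneg measureReal_le_one measureReal_nonneg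
      measureReal_le_one
  | succ q ih =>
    rw [mul_add_one, ← add_assoc, Kernel.pow_add_real_eq_integral _ _ _ hA,
      Kernel.pow_add_real_eq_integral _ _ _ hA]
    have := hcontr _ (Kernel.measurable_real (κ := κ) (r + k * q) hA) _ (by positivity) ih x y
    rwa [← mul_assoc, ← pow_succ'] at this

/-- A contraction rate over blocks of `k` steps gives one for single steps. -/
lemma exists_rate {θ : ℝ} (hθ0 : 0 < θ) (hθ : θ < 1) {k : ℕ} (hk : k ≠ 0) :
    ∃ ρ : ℝ, 0 < ρ ∧ ρ < 1 ∧ ∀ n : ℕ, θ ^ (n / k) ≤ θ⁻¹ * ρ ^ n := by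
  refine ⟨θ ^ (1 / k : ℝ), by positivity, Real.rpow_lt_one hθ0.le hθ (by positivity), fun n => ?_⟩
  have hk' : (0 : ℝ) < k := by positivity
  rw [← Real.rpow_natCast, ← Real.rpow_natCast, ← Real.rpow_mul hθ0.le, ← Real.rpow_neg_one,
    ← Real.rpow_add hθ0]
  refine Real.rpow_le_rpow_of_exponent_ge hθ0 hθ.le ?_
  have : (n : ℝ) < k * ((n / k : ℕ) + 1) := by
    exact_mod_cast Nat.lt_mul_div_succ n (Nat.pos_of_ne_zero hk)
  have h2 : 1 / (k : ℝ) * n < (n / k : ℕ) + 1 := by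
    rw [one_div, inv_mul_lt_iff₀ hk']; exact this
  linarith

/-- Harris' theorem for a chain with an atom: if `V` satisfies a geometric drift condition and the
point `z` is reached in `k` steps with probability bounded below on each sublevel set of `V`, the
chain is geometrically ergodic. -/
theorem isGeometricallyErgodic_of_drift {S : Type*} [MeasurableSpace S]
    [MeasurableSingletonClass S] {κ : Kernel S S} [IsMarkovKernel κ] {V : S → NNReal}
    (hV : Measurable V) {γ K : NNReal} (hγ : γ < 1)
    (hdrift : ∀ x, ∫⁻ y, V y ∂κ x ≤ γ * V x + K) (z : S) {k : ℕ} (hk : k ≠ 0)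
    (hmin : ∀ R : ℝ, ∃ α : ℝ, 0 < α ∧ ∀ x, V x ≤ R → α ≤ ((κ ^ k) x).real {z}) :
    IsGeometricallyErgodic κ := by
  have hVfin : ∀ n x, ∫⁻ y, V y ∂(κ ^ n) x ≠ ⊤ := fun n x =>
    ne_top_of_le_ne_top (by finiteness) (Kernel.lintegral_pow_le hV hγ.le hdrift n x)
  have hVint : ∀ n x, Integrable (fun y => (V y : ℝ)) ((κ ^ n) x) := fun n x => by
    refine ⟨hV.coe_nnreal_real.aestronglyMeasurable, ?_⟩
    rw [hasFiniteIntegral_iff_ofNNReal]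
    exact (hVfin n x).lt_top
  have hVdrift : ∀ (n : ℕ) x, ∫ y, (V y : ℝ) ∂(κ ^ n) x ≤ (γ : ℝ) ^ n * V x + n * K := fun n x => by
    rw [integral_eq_lintegral_of_nonneg_ae (ae_of_all _ fun y => NNReal.coe_nonneg _)
      hV.coe_nnreal_real.aestronglyMeasurable]
    simp only [ENNReal.ofReal_coe_nnreal]
    refine ENNReal.toReal_le_of_le_ofReal (by positivity) ?_
    refine (Kernel.lintegral_pow_le hV hγ.le hdrift n x).trans (le_of_eq ?_)
    rw [← ENNReal.coe_mul, ← ENNReal.coe_add, ← ENNReal.ofReal_coe_nnreal]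
    push_cast; rfl
  have hγk : (γ : ℝ) ^ k < 1 := pow_lt_one₀ γ.2 (by exact_mod_cast hγ) hk
  have hγk' : 0 < 1 - (γ : ℝ) ^ k := by linarith
  -- The added `1` makes the constant positive, as the choice of `β` below requires.
  set K' : ℝ := k * K + 1 with hK'
  have hK'0 : 0 < K' := by positivity
  obtain ⟨α, hα0, hα⟩ := hmin (4 * K' / (1 - (γ : ℝ) ^ k))
  obtain ⟨β, θ, hβ0, hθ0, hθ1, hlarge, hsmall⟩ := exists_contraction_constants (by positivity)
    hγk hK'0 (R := 4 * K' / (1 - (γ : ℝ) ^ k)) (by field_simp; rfl) hα0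
  obtain ⟨ρ, hρ0, hρ1, hρ⟩ := exists_rate hθ0 hθ1 hk
  have hpair : ∀ n x y A, MeasurableSet A → |((κ ^ n) x).real A - ((κ ^ n) y).real A| ≤
      θ⁻¹ * ρ ^ n * (1 + β / 2 * (V x + V y)) := by
    intro n x y A hA
    have h := abs_pow_real_sub_le (κ := κ) (k := k) (w := fun x y => 2 + β * (V x + V y)) (θ := θ)
      hθ0.le (fun x y => by
        have : 0 ≤ β * ((V x : ℝ) + V y) := by positivity
        linarith)
      (fun φ hφ A hA hosc x y => abs_integral_sub_integral_le (V := fun x => (V x : ℝ))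
        (fun x => (V x).2) hβ0.le hα0.le (hVint k)
        (fun x => (hVdrift k x).trans (by linarith)) hα hlarge hsmall hφ hA hosc x y)
      hA (n / k) (n % k) x y
    rw [Nat.mod_add_div] at h
    refine h.trans ?_
    calc _ = θ ^ (n / k) * (1 + β / 2 * (V x + V y)) := by ring
      _ ≤ _ := by gcongr; exact hρ n
  -- Averaging over the first step turns this into a bound on consecutive laws from `z`.
  have hstep : ∀ n A, MeasurableSet A → |((κ ^ n) z).real A - ((κ ^ (n + 1)) z).real A| ≤
      θ⁻¹ * (1 + β / 2 * (V z + (γ * V z + K))) * ρ ^ n := by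
    intro n A hA
    have hi : Integrable (fun y => ((κ ^ n) y).real A) ((κ ^ 1) z) :=
      Integrable.of_bound (Kernel.measurable_real n hA).aestronglyMeasurable 1
        (ae_of_all _ fun y => by
          rw [Real.norm_of_nonneg measureReal_nonneg]; exact measureReal_le_one)
    have hg : Integrable (fun y => θ⁻¹ * ρ ^ n * (1 + β / 2 * (V z + V y))) ((κ ^ 1) z) :=
      ((integrable_const 1).add
        (((integrable_const (V z : ℝ)).add (hVint 1 z)).const_mul _)).const_mul _
    have e : ((κ ^ n) z).real A - ((κ ^ (n + 1)) z).real A =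
        ∫ y, (((κ ^ n) z).real A - ((κ ^ n) y).real A) ∂(κ ^ 1) z := by
      rw [integral_sub (integrable_const _) hi, Kernel.pow_add_real_eq_integral n 1 z hA]
      simp
    rw [e]
    refine abs_integral_le_integral_abs.trans ?_
    refine (integral_mono ((integrable_const _).sub hi).abs hg
      fun y => hpair n z y A hA).trans ?_
    have hi' : Integrable (fun y => (V z : ℝ) + V y) ((κ ^ 1) z) :=
      (integrable_const _).add (hVint 1 z)
    rw [integral_const_mul, integral_add (integrable_const 1) (hi'.const_mul _),
      integral_const_mul, integral_add (integrable_const _) (hVint 1 z)]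
    simp only [integral_const, probReal_univ, smul_eq_mul, one_mul]
    have := hVdrift 1 z
    simp only [pow_one, Nat.cast_one, one_mul] at this
    rw [mul_right_comm]
    simp only [pow_one]
    gcongr
  obtain ⟨μ, hμ, hconv⟩ := exists_measure_of_geometric (fun n => (κ ^ n) z) hρ0.le hρ1 hstep
  set C := θ⁻¹ * (1 + β / 2 * (V z + (γ * V z + K))) with hC
  have hC0 : 0 ≤ C := by positivity
  refine ⟨μ, hμ, ?_, ρ, hρ0, hρ1, fun x => ⟨θ⁻¹ * (1 + β / 2 * (V x + V z)) + C / (1 - ρ),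
    fun n => ?_⟩⟩
  · -- The values at time `n + 1` converge both to those of `μ` and to those of its image under `κ`.
    rw [Kernel.Invariant]
    ext A hA
    have herr : Tendsto (fun n => C * ρ ^ n / (1 - ρ)) atTop (𝓝 0) := by
      simpa using
        ((tendsto_pow_atTop_nhds_zero_of_lt_one hρ0.le hρ1).const_mul C).div_const (1 - ρ)
    have h1 : Tendsto (fun n => ((κ ^ (1 + n)) z).real A) atTop (𝓝 (∫ y, (κ y).real A ∂μ)) := by
      rw [tendsto_iff_norm_sub_tendsto_zero]
      refine squeeze_zero (fun _ => norm_nonneg _) (fun n => ?_) herr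
      rw [Kernel.pow_add_real_eq_integral 1 n z hA, pow_one]
      exact abs_integral_sub_le_of_forall_abs_measureReal_sub_le (hconv n)
        (by simpa using Kernel.measurable_real (κ := κ) 1 hA) (fun _ => measureReal_nonneg)
        fun _ => measureReal_le_one
    have h2 : Tendsto (fun n => ((κ ^ (1 + n)) z).real A) atTop (𝓝 (μ.real A)) := by
      have : Tendsto (fun n => ((κ ^ n) z).real A) atTop (𝓝 (μ.real A)) := by
        rw [tendsto_iff_norm_sub_tendsto_zero]
        exact squeeze_zero (fun _ => norm_nonneg _) (fun n => hconv n A hA) herr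
      exact this.comp (tendsto_add_atTop_nat 1 |>.congr fun n => add_comm n 1)
    have h3 := tendsto_nhds_unique h1 h2
    rw [← measureReal_eq_measureReal_iff (measure_ne_top _ _) (measure_ne_top _ _), ← h3,
      measureReal_def,
      Measure.bind_apply hA κ.measurable.aemeasurable]
    exact (integral_toReal (Kernel.measurable_coe _ hA).aemeasurable
      (ae_of_all _ fun _ => measure_lt_top _ _)).symm
  · have : 0 < 1 - ρ := by linarith
    refine Real.iSup_le (fun A => ?_) (by positivity)
    calc _ ≤ |((κ ^ n) x).real A.1 - ((κ ^ n) z).real A.1| + |((κ ^ n) z).real A.1 - μ.real A.1| :=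
          abs_sub_le _ _ _
      _ ≤ θ⁻¹ * ρ ^ n * (1 + β / 2 * (V x + V z)) + C * ρ ^ n / (1 - ρ) :=
          add_le_add (hpair n x z A.1 A.2) (hconv n A.1 A.2)
      _ = _ := by ring

/-! ### Positive solutions of linear recursions -/

/-- The cubic `X³ - a X² - b X - c` is `(X + d) * (X² - σ X + t)` with `-d < 0` its real root and
a quadratic factor without real roots. -/
lemma exists_quadratic_factor {a b c : ℝ} (hc : c < 0)
    (hdisc : a ^ 2 * b ^ 2 + 4 * b ^ 3 - 4 * a ^ 3 * c - 18 * a * b * c - 27 * c ^ 2 < 0) :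
    ∃ d σ t : ℝ, 0 < d ∧ 0 < t ∧ σ ^ 2 < 4 * t ∧ a = σ - d ∧ b = σ * d - t ∧ c = -(t * d) := by
  obtain ⟨α, hα, hroot⟩ : ∃ α < 0, α ^ 3 - a * α ^ 2 - b * α - c = 0 := by
    set M := 1 + |a| + |b| + |c| with hM
    have hcont : ContinuousOn (fun x : ℝ => x ^ 3 - a * x ^ 2 - b * x - c) (Set.Icc (-M) 0) := by
      fun_prop
    have hM1 : 1 ≤ M := by rw [hM]; linarith [abs_nonneg a, abs_nonneg b, abs_nonneg c]
    have hneg : (-M) ^ 3 - a * (-M) ^ 2 - b * (-M) - c ≤ 0 := by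
      have h1 : M ≤ M ^ 2 := by nlinarith
      have ha : -a * M ^ 2 ≤ |a| * M ^ 2 := by gcongr; exact neg_le_abs a
      have hb : b * M ≤ |b| * M ^ 2 :=
        (mul_le_mul_of_nonneg_right (le_abs_self b) (by linarith)).trans (by gcongr)
      have hc' : -c ≤ |c| * M ^ 2 :=
        (neg_le_abs c).trans (le_mul_of_one_le_right (abs_nonneg c) (by linarith))
      have : M ^ 3 = (1 + |a| + |b| + |c|) * M ^ 2 := by rw [← hM]; ring
      nlinarith
    obtain ⟨α, hα, h0⟩ := intermediate_value_Icc (by linarith : -M ≤ 0) hcont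
      (show (0 : ℝ) ∈ Set.Icc _ _ from ⟨hneg, by linarith⟩)
    refine ⟨α, lt_of_le_of_ne hα.2 ?_, h0⟩
    rintro rfl
    simp only at h0
    linarith
  have hc_eq : c = α ^ 3 - a * α ^ 2 - b * α := by linarith
  have hα2 : (a - α) ^ 2 < 4 * (α ^ 2 - a * α - b) := by
    -- The discriminant of a cubic with root `α` is that of the quadratic factor times a square.
    have e : a ^ 2 * b ^ 2 + 4 * b ^ 3 - 4 * a ^ 3 * c - 18 * a * b * c - 27 * c ^ 2 =
        ((a - α) ^ 2 - 4 * (α ^ 2 - a * α - b)) * (3 * α ^ 2 - 2 * a * α - b) ^ 2 := by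
      rw [hc_eq]; ring
    by_contra! h
    rw [e] at hdisc
    exact absurd hdisc (not_lt.2 (mul_nonneg (by linarith) (sq_nonneg _)))
  exact ⟨-α, a - α, α ^ 2 - a * α - b, by linarith, by nlinarith [sq_nonneg (a - α)], hα2,
    by ring, by ring, by rw [hc_eq]; ring⟩

/-- A positive solution of `y (n + 2) = σ * y (n + 1) - t * y n` with complex characteristic roots
has bounded length: each step lowers the ratio `y (n + 2) / y (n + 1)` by at least
`δ = 2 * √t - |σ|`, because `u ^ 2 - (σ + δ) * u + t ≥ 0`. -/
lemma exists_length_positive_solution {σ t : ℝ} (ht : 0 < t) (h : σ ^ 2 < 4 * t) :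
    ∃ N : ℕ, ∀ y : ℕ → ℝ, 0 ≤ y 0 → (∀ n ≤ N, 0 < y (n + 1)) →
      ¬ ∀ n ≤ N, y (n + 2) = σ * y (n + 1) - t * y n := by
  set δ := 2 * √t - |σ| with hδ
  have hs : √t ^ 2 = t := Real.sq_sqrt ht.le
  have hδ0 : 0 < δ := by
    have : |σ| < 2 * √t := abs_lt_of_sq_lt_sq (by nlinarith) (by positivity)
    linarith
  have hquad : ∀ u : ℝ, 0 ≤ u → 0 ≤ u ^ 2 - (σ + δ) * u + t := fun u hu => by
    have : (σ + δ) * u ≤ 2 * √t * u := by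
      gcongr; rw [hδ]; linarith [le_abs_self σ]
    nlinarith [sq_nonneg (u - √t)]
  obtain ⟨N, hN⟩ := exists_nat_gt (σ / δ)
  rw [div_lt_iff₀ hδ0] at hN
  refine ⟨N + 1, fun y hy0 hpos hrec => ?_⟩
  have key : ∀ n ≤ N, y (n + 2) ≤ (σ - n * δ) * y (n + 1) := by
    intro n
    induction n with
    | zero => intro _; rw [hrec 0 (by lia)]; have := mul_nonneg ht.le hy0; simp; linarith
    | succ n ih =>
      intro hn
      have ih := ih (by lia)
      have h1 := hpos n (by lia)
      have h2 := hpos (n + 1) (by lia)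
      set u := σ - n * δ with hu
      have hu0 : 0 < u := by
        by_contra! hneg
        nlinarith [mul_nonneg (neg_nonneg.2 hneg) h1.le]
      rw [hrec (n + 1) (by lia)]
      have h3 : 0 ≤ t * (u * y (n + 1) - y (n + 2)) := mul_nonneg ht.le (by linarith)
      have h4 := mul_nonneg (hquad u hu0.le) h2.le
      have h5 : σ - ((n + 1 : ℕ) : ℝ) * δ = u - δ := by push_cast; rw [hu]; ring
      rw [h5]
      have : u * (σ * y (n + 2) - t * y (n + 1)) ≤ u * ((u - δ) * y (n + 2)) := by nlinarith
      exact le_of_mul_le_mul_left this hu0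
  have h1 := key N le_rfl
  have h2 := hpos (N + 1) le_rfl
  have h3 := hpos N (by lia)
  nlinarith

/-- The nonnegative solutions of the truncated recursion vanish after a time that does not depend
on the initial values. -/
lemma exists_forall_eq_zero {a b c : ℝ} (hb : b < 0) (hc : c < 0)
    (hdisc : a ^ 2 * b ^ 2 + 4 * b ^ 3 - 4 * a ^ 3 * c - 18 * a * b * c - 27 * c ^ 2 < 0) :
    ∃ N : ℕ, ∀ z : ℕ → ℝ, (∀ n, 0 ≤ z n) →
      (∀ n, z (n + 3) = max 0 (a * z (n + 2) + b * z (n + 1) + c * z n)) →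
      ∀ n, N ≤ n → z n = 0 := by
  obtain ⟨d, σ, t, hd, ht, hσ, rfl, hb', hc'⟩ := exists_quadratic_factor hc hdisc
  obtain ⟨N, hN⟩ := exists_length_positive_solution ht hσ
  refine ⟨N + 3, fun z hz hrec => ?_⟩
  have hstay : ∀ n, z (n + 2) = 0 → ∀ m, z (m + (n + 2)) = 0 := fun n h0 m => by
    induction m with
    | zero => simpa using h0
    | succ m ih =>
      have e := hrec (m + n)
      rw [show m + n + 2 = m + (n + 2) by ring, ih] at e
      rw [show m + 1 + (n + 2) = m + n + 3 by ring, e]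
      refine max_eq_left ?_
      nlinarith [hz (m + n + 1), hz (m + n)]
  suffices h : ∃ n ≤ N + 1, z (n + 2) = 0 by
    obtain ⟨n, hn, h0⟩ := h
    intro m hm
    have := hstay n h0 (m - (n + 2))
    rwa [Nat.sub_add_cancel (by lia)] at this
  by_contra! hne
  have hpos : ∀ n ≤ N + 1, 0 < z (n + 2) := fun n hn => lt_of_le_of_ne (hz _) (hne n hn).symm
  have hlin : ∀ n ≤ N, z (n + 3) = (σ - d) * z (n + 2) + b * z (n + 1) + c * z n := fun n hn => by
    have h1 := hrec n
    have h2 := hpos (n + 1) (by lia)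
    rcases max_choice 0 ((σ - d) * z (n + 2) + b * z (n + 1) + c * z n) with h | h
    · rw [h1, h] at h2; exact absurd h2 (lt_irrefl _)
    · rw [h1, h]
  refine hN (fun n => z (n + 1) + d * z n) (add_nonneg (hz _) (mul_nonneg hd.le (hz _)))
    (fun n hn => add_pos_of_pos_of_nonneg (hpos n (by lia)) (mul_nonneg hd.le (hz _)))
    fun n hn => ?_
  rw [hlin n hn, hb', hc']
  ring

/-! ### The deterministic skeleton -/

/-- The deterministic skeleton of the chain: the positively homogeneous map
`(i, j, k) ↦ ((a i + b j + c k)₊, i, j)`. -/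
def hawkesFlow (a b c : ℝ) (x : ℝ × ℝ × ℝ) : ℝ × ℝ × ℝ :=
  (max 0 (a * x.1 + b * x.2.1 + c * x.2.2), x.1, x.2.1)

/-- The `ℓ¹` norm on `ℝ³`. -/
def l1Norm (x : ℝ × ℝ × ℝ) : ℝ := |x.1| + |x.2.1| + |x.2.2|

lemma l1Norm_nonneg (x : ℝ × ℝ × ℝ) : 0 ≤ l1Norm x := by unfold l1Norm; positivity

lemma l1Norm_le_add_sub (x y : ℝ × ℝ × ℝ) : l1Norm x ≤ l1Norm y + l1Norm (x - y) := by
  simp only [l1Norm, Prod.fst_sub, Prod.snd_sub]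
  linarith [abs_sub_abs_le_abs_sub x.1 y.1, abs_sub_abs_le_abs_sub x.2.1 y.2.1,
    abs_sub_abs_le_abs_sub x.2.2 y.2.2]

lemma abs_linear_le (a b c : ℝ) (x : ℝ × ℝ × ℝ) :
    |a * x.1 + b * x.2.1 + c * x.2.2| ≤ (|a| + |b| + |c|) * l1Norm x := by
  refine (abs_add_three _ _ _).trans ?_
  rw [abs_mul, abs_mul, abs_mul, l1Norm]
  have := abs_nonneg x.1; have := abs_nonneg x.2.1; have := abs_nonneg x.2.2
  have := abs_nonneg a; have := abs_nonneg b; have := abs_nonneg c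
  have h1 : 0 ≤ |a| * (|x.2.1| + |x.2.2|) := by positivity
  have h2 : 0 ≤ |b| * (|x.1| + |x.2.2|) := by positivity
  have h3 : 0 ≤ |c| * (|x.1| + |x.2.1|) := by positivity
  linarith

lemma l1Norm_hawkesFlow_sub_le (a b c : ℝ) (x y : ℝ × ℝ × ℝ) :
    l1Norm (hawkesFlow a b c x - hawkesFlow a b c y) ≤
      (1 + |a| + |b| + |c|) * l1Norm (x - y) := by
  have h1 := abs_max_sub_max_le_abs (a * x.1 + b * x.2.1 + c * x.2.2)
    (a * y.1 + b * y.2.1 + c * y.2.2) 0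
  rw [max_comm _ 0, max_comm _ 0] at h1
  have h2 := abs_linear_le a b c (x - y)
  have h3 : a * (x - y).1 + b * (x - y).2.1 + c * (x - y).2.2 =
      a * x.1 + b * x.2.1 + c * x.2.2 - (a * y.1 + b * y.2.1 + c * y.2.2) := by
    simp only [Prod.fst_sub, Prod.snd_sub]; ring
  rw [h3] at h2
  have h4 : l1Norm (hawkesFlow a b c x - hawkesFlow a b c y) ≤
      |a * x.1 + b * x.2.1 + c * x.2.2 - (a * y.1 + b * y.2.1 + c * y.2.2)| + l1Norm (x - y) := by
    simp only [l1Norm, hawkesFlow, Prod.fst_sub, Prod.snd_sub]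
    linarith [abs_nonneg (x.2.2 - y.2.2)]
  linarith

lemma l1Norm_iterate_hawkesFlow_sub_le (a b c : ℝ) (n : ℕ) (x y : ℝ × ℝ × ℝ) :
    l1Norm ((hawkesFlow a b c)^[n] x - (hawkesFlow a b c)^[n] y) ≤
      (1 + |a| + |b| + |c|) ^ n * l1Norm (x - y) := by
  induction n with
  | zero => simp
  | succ n ih =>
    rw [Function.iterate_succ_apply', Function.iterate_succ_apply']
    calc _ ≤ (1 + |a| + |b| + |c|) * _ := l1Norm_hawkesFlow_sub_le _ _ _ _ _
      _ ≤ (1 + |a| + |b| + |c|) * ((1 + |a| + |b| + |c|) ^ n * l1Norm (x - y)) := by gcongr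
      _ = _ := by ring

/-- The deterministic skeleton is nilpotent on the nonnegative cone. -/
lemma exists_iterate_hawkesFlow_eq_zero {a b c : ℝ} (hb : b < 0) (hc : c < 0)
    (hdisc : a ^ 2 * b ^ 2 + 4 * b ^ 3 - 4 * a ^ 3 * c - 18 * a * b * c - 27 * c ^ 2 < 0) :
    ∃ N : ℕ, ∀ x : ℝ × ℝ × ℝ, 0 ≤ x.1 → (hawkesFlow a b c)^[N + 1] x = 0 := by
  obtain ⟨N, hN⟩ := exists_forall_eq_zero hb hc hdisc
  refine ⟨N + 1, fun x hx => ?_⟩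
  set D := hawkesFlow a b c with hD
  have h1 : ∀ n, (D^[n + 1] x).2.1 = (D^[n] x).1 := fun n => by
    rw [Function.iterate_succ_apply']; rfl
  have h2 : ∀ n, (D^[n + 2] x).2.2 = (D^[n] x).1 := fun n => by
    rw [Function.iterate_succ_apply', ← h1]; rfl
  have hz := hN (fun n => (D^[n] x).1) (fun n => by
    cases n with
    | zero => exact hx
    | succ n => rw [Function.iterate_succ_apply']; exact le_max_left _ _) (fun n => by
    rw [← h2 n, ← h1 (n + 1), Function.iterate_succ_apply' D (n + 2)]; rfl)
  refine Prod.ext (hz _ (by lia)) (Prod.ext ?_ ?_)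
  · exact (h1 _).trans (hz _ (by lia))
  · exact (h2 _).trans (hz _ le_rfl)

/-! ### Fluctuations of Poisson variables -/

/-- The size-biasing identity `E[X f(X)] = r E[f(X + 1)]` of a Poisson variable `X` of parameter
`r`, for series. -/
lemma hasSum_poisson_weight_mul (r : NNReal) {f : ℕ → ℝ} {s : ℝ}
    (h : HasSum (fun n => Real.exp (-r) * r ^ n / n.factorial * f (n + 1)) s) :
    HasSum (fun n => Real.exp (-r) * r ^ n / n.factorial * (n * f n)) (r * s) := by
  rw [← hasSum_nat_add_iff' 1]
  simp only [Finset.sum_range_one, Nat.cast_zero, zero_mul, mul_zero, sub_zero]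
  have e : ∀ n : ℕ, Real.exp (-r) * r ^ (n + 1) / (n + 1).factorial * ((n + 1 : ℕ) * f (n + 1)) =
      r * (Real.exp (-r) * r ^ n / n.factorial * f (n + 1)) := fun n => by
    rw [Nat.factorial_succ]
    push_cast
    field_simp
    ring
  simpa only [e] using h.mul_left (r : ℝ)

lemma hasSum_variance_poisson (r : NNReal) :
    HasSum (fun n : ℕ => Real.exp (-r) * r ^ n / n.factorial * ((n : ℝ) - r) ^ 2) r := by
  have h0 := hasSum_one_poissonMeasure r
  have h1 : HasSum (fun n : ℕ => Real.exp (-r) * r ^ n / n.factorial * (n : ℝ)) r := by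
    have := hasSum_poisson_weight_mul r (f := fun _ => 1) (s := 1)
      (by simpa only [mul_one] using h0)
    simpa only [mul_one] using this
  have h2 : HasSum (fun n : ℕ => Real.exp (-r) * r ^ n / n.factorial * ((n : ℝ) * n))
      (r * (r + 1)) := by
    refine hasSum_poisson_weight_mul r (f := fun n => n) ?_
    simpa only [Nat.cast_add, Nat.cast_one, mul_add, mul_one] using h1.add h0
  have h := (h2.sub (h1.mul_left (2 * (r : ℝ)))).add (h0.mul_left ((r : ℝ) ^ 2))
  rw [show (r : ℝ) * (r + 1) - 2 * r * r + r ^ 2 * 1 = r by ring] at h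
  have e : ∀ n : ℕ, Real.exp (-r) * r ^ n / n.factorial * ((n : ℝ) - r) ^ 2 =
      Real.exp (-r) * r ^ n / n.factorial * ((n : ℝ) * n) -
        2 * r * (Real.exp (-r) * r ^ n / n.factorial * n) +
        (r : ℝ) ^ 2 * (Real.exp (-r) * r ^ n / n.factorial) := fun n => by ring
  simpa only [e] using h

lemma integrable_sq_sub_poissonMeasure (r : NNReal) :
    Integrable (fun n : ℕ => ((n : ℝ) - r) ^ 2) (poissonMeasure r) := by
  rw [integrable_poissonMeasure_iff]
  simpa using (hasSum_variance_poisson r).summable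

lemma integral_sq_sub_poissonMeasure (r : NNReal) :
    ∫ n, ((n : ℝ) - r) ^ 2 ∂poissonMeasure r = r := by
  rw [integral_poissonMeasure]
  exact (hasSum_variance_poisson r).tsum_eq

/-- The mean deviation of a Poisson variable is at most `√r`; by the inequality of arithmetic and
geometric means this is less than any multiple of `r`, up to a constant. -/
lemma lintegral_ofReal_abs_sub_poissonMeasure_le (r : NNReal) {A B η : ℝ} (hA : 0 ≤ A) (hB : 0 ≤ B)
    (hη : 0 < η) :
    ∫⁻ n, ENNReal.ofReal (A + B * |(n : ℝ) - r|) ∂poissonMeasure r ≤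
      ENNReal.ofReal (A + B * (η * r + 1 / (4 * η))) := by
  have hle : ∀ n : ℕ, A + B * |(n : ℝ) - r| ≤
      A + B * (η * ((n : ℝ) - r) ^ 2 + 1 / (4 * η)) := fun n => by
    have h : |(n : ℝ) - r| ≤ η * |(n : ℝ) - r| ^ 2 + 1 / (4 * η) := by
      have e : η * |(n : ℝ) - r| ^ 2 + 1 / (4 * η) - |(n : ℝ) - r| =
          η * (|(n : ℝ) - r| - 1 / (2 * η)) ^ 2 := by field_simp; ring
      have : 0 ≤ η * (|(n : ℝ) - r| - 1 / (2 * η)) ^ 2 := by positivity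
      linarith
    rw [sq_abs] at h
    gcongr
  have hi := (integrable_sq_sub_poissonMeasure r).const_mul η
  have hi' : Integrable (fun n : ℕ => η * ((n : ℝ) - r) ^ 2 + 1 / (4 * η)) (poissonMeasure r) :=
    hi.add (integrable_const _)
  calc _ ≤ ∫⁻ n : ℕ, ENNReal.ofReal (A + B * (η * ((n : ℝ) - r) ^ 2 + 1 / (4 * η)))
        ∂poissonMeasure r := lintegral_mono fun n => ENNReal.ofReal_le_ofReal (hle n)
    _ = ENNReal.ofReal (∫ n : ℕ, (A + B * (η * ((n : ℝ) - r) ^ 2 + 1 / (4 * η)))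
        ∂poissonMeasure r) :=
      (ofReal_integral_eq_lintegral_ofReal ((integrable_const A).add (hi'.const_mul B))
        (ae_of_all _ fun n => by
          simp only [Pi.zero_apply, Pi.add_apply]; positivity)).symm
    _ = _ := by
      have e1 : ∫ n : ℕ, (η * ((n : ℝ) - r) ^ 2 + 1 / (4 * η)) ∂poissonMeasure r =
          η * r + 1 / (4 * η) := by
        rw [integral_add hi (integrable_const _), integral_const_mul,
          integral_sq_sub_poissonMeasure]
        simp
      rw [integral_add (integrable_const A) (hi'.const_mul B), integral_const_mul]
      rw [e1]; simp

/-! ### The Lyapunov function -/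

/-- The sum `∑ j < N, 4 ^ j * ‖D^j x‖₁`, with `D` the deterministic skeleton. It is used with an
`N` such that `D^N` vanishes on the nonnegative cone; the ratio `4` leaves room for the Poisson
fluctuations in a drift of factor `1 / 2`. -/
def hawkesLyapunov (a b c : ℝ) (N : ℕ) (x : ℝ × ℝ × ℝ) : ℝ :=
  ∑ j ∈ Finset.range N, 4 ^ j * l1Norm ((hawkesFlow a b c)^[j] x)

lemma hawkesLyapunov_nonneg (a b c : ℝ) (N : ℕ) (x : ℝ × ℝ × ℝ) : 0 ≤ hawkesLyapunov a b c N x :=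
  Finset.sum_nonneg fun _ _ => mul_nonneg (by positivity) (l1Norm_nonneg _)

lemma l1Norm_le_hawkesLyapunov (a b c : ℝ) (N : ℕ) (x : ℝ × ℝ × ℝ) :
    l1Norm x ≤ hawkesLyapunov a b c (N + 1) x := by
  have := Finset.single_le_sum (f := fun j => (4 : ℝ) ^ j * l1Norm ((hawkesFlow a b c)^[j] x))
    (fun j _ => mul_nonneg (by positivity) (l1Norm_nonneg _)) (Finset.mem_range.2 N.succ_pos)
  simpa [hawkesLyapunov] using this

/-- The shift moves the weights `4 ^ j` down by one and loses nothing at the end of the sum, where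
the orbit has reached the origin. -/
lemma hawkesLyapunov_hawkesFlow_le {a b c : ℝ} {N : ℕ} {x : ℝ × ℝ × ℝ}
    (h : (hawkesFlow a b c)^[N] x = 0) :
    hawkesLyapunov a b c N (hawkesFlow a b c x) ≤ hawkesLyapunov a b c N x / 4 := by
  have h0 : l1Norm 0 = 0 := by simp [l1Norm]
  have e : hawkesLyapunov a b c N x + 4 ^ N * l1Norm ((hawkesFlow a b c)^[N] x) =
      4 * hawkesLyapunov a b c N (hawkesFlow a b c x) + l1Norm x := by
    rw [hawkesLyapunov, ← Finset.sum_range_succ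
      (fun j => (4 : ℝ) ^ j * l1Norm ((hawkesFlow a b c)^[j] x)), Finset.sum_range_succ',
      hawkesLyapunov, Finset.mul_sum]
    simp [pow_succ', mul_assoc]
  rw [h, h0] at e
  linarith [l1Norm_nonneg x]

lemma hawkesLyapunov_le_add (a b c : ℝ) (N : ℕ) (x y : ℝ × ℝ × ℝ) :
    hawkesLyapunov a b c N x ≤ hawkesLyapunov a b c N y +
      (∑ j ∈ Finset.range N, (4 * (1 + |a| + |b| + |c|)) ^ j) * l1Norm (x - y) := by
  rw [hawkesLyapunov, hawkesLyapunov, Finset.sum_mul, ← Finset.sum_add_distrib]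
  refine Finset.sum_le_sum fun j _ => ?_
  rw [mul_pow, mul_assoc, ← mul_add]
  gcongr
  exact (l1Norm_le_add_sub _ _).trans
    (by gcongr; exact l1Norm_iterate_hawkesFlow_sub_le a b c j x y)

/-- The embedding of the state space `ℕ³` into `ℝ³`. -/
def stateToReal (x : ℕ × ℕ × ℕ) : ℝ × ℝ × ℝ := (x.1, x.2.1, x.2.2)

lemma l1Norm_stateToReal (x : ℕ × ℕ × ℕ) : l1Norm (stateToReal x) = x.1 + x.2.1 + x.2.2 := by
  simp [l1Norm, stateToReal]

lemma hawkesIntensity_le {lam : ℝ} (hlam : 0 < lam) (a b c : ℝ) (x : ℕ × ℕ × ℕ) :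
    (hawkesIntensity a b c lam x : ℝ) ≤ (|a| + |b| + |c|) * l1Norm (stateToReal x) + lam := by
  rw [hawkesIntensity, Real.coe_toNNReal']
  have h := (le_abs_self _).trans (abs_linear_le a b c (stateToReal x))
  have h0 : 0 ≤ (|a| + |b| + |c|) * l1Norm (stateToReal x) :=
    mul_nonneg (by positivity) (l1Norm_nonneg _)
  exact max_le (by simp only [stateToReal] at h ⊢; linarith) (by linarith)

/-- The next state is the image under the deterministic skeleton, up to the immigration rate and
the Poisson fluctuation. -/
lemma l1Norm_next_sub_hawkesFlow_le {lam : ℝ} (hlam : 0 < lam) (a b c : ℝ) (x : ℕ × ℕ × ℕ)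
    (l : ℕ) :
    l1Norm (stateToReal (l, x.1, x.2.1) - hawkesFlow a b c (stateToReal x)) ≤
      |(l : ℝ) - hawkesIntensity a b c lam x| + lam := by
  simp only [l1Norm, stateToReal, hawkesFlow, Prod.fst_sub, Prod.snd_sub, sub_self]
  simp only [Prod.fst_zero, Prod.snd_zero, abs_zero, add_zero]
  have h := abs_max_sub_max_le_abs (a * x.1 + b * x.2.1 + c * x.2.2 + lam)
    (a * x.1 + b * x.2.1 + c * x.2.2) 0
  rw [add_sub_cancel_left, abs_of_pos hlam, max_comm _ 0, max_comm _ 0] at h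
  rw [hawkesIntensity, Real.coe_toNNReal', max_comm _ 0]
  exact (abs_sub_le _ (max 0 (a * x.1 + b * x.2.1 + c * x.2.2 + lam)) _).trans
    (add_le_add_right h _)

lemma lintegral_hawkesKernel (a b c lam : ℝ) (x : ℕ × ℕ × ℕ) (f : ℕ × ℕ × ℕ → ENNReal) :
    ∫⁻ y, f y ∂hawkesKernel a b c lam x =
      ∫⁻ l, f (l, x.1, x.2.1) ∂poissonMeasure (hawkesIntensity a b c lam x) := by
  change ∫⁻ y, f y ∂((poissonMeasure (hawkesIntensity a b c lam x)).map
    (fun l : ℕ => (l, x.1, x.2.1))) = _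
  rw [lintegral_map .of_discrete .of_discrete]

/-- One step of the chain halves the Lyapunov function, up to a constant. -/
lemma exists_drift {lam : ℝ} (hlam : 0 < lam) {a b c : ℝ} {N : ℕ}
    (hN : ∀ x : ℝ × ℝ × ℝ, 0 ≤ x.1 → (hawkesFlow a b c)^[N + 1] x = 0) :
    ∃ K : NNReal, ∀ x : ℕ × ℕ × ℕ,
      ∫⁻ y, (hawkesLyapunov a b c (N + 1) (stateToReal y)).toNNReal ∂hawkesKernel a b c lam x ≤
        (2⁻¹ : NNReal) * (hawkesLyapunov a b c (N + 1) (stateToReal x)).toNNReal + K := by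
  set L := |a| + |b| + |c| with hL
  have hL0 : 0 ≤ L := by positivity
  set C := ∑ j ∈ Finset.range (N + 1), (4 * (1 + |a| + |b| + |c|)) ^ j with hC
  have hC0 : 0 ≤ C := Finset.sum_nonneg fun _ _ => by positivity
  -- The fluctuation term must cost at most a quarter of the Lyapunov function.
  obtain ⟨η, hη0, hη⟩ : ∃ η : ℝ, 0 < η ∧ C * (η * L) ≤ 1 / 4 := by
    refine ⟨1 / (4 * (C * L + 1)), by positivity, ?_⟩
    rw [show C * (1 / (4 * (C * L + 1)) * L) = C * L / (4 * (C * L + 1)) by ring,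
      div_le_iff₀ (by positivity)]
    nlinarith [mul_nonneg hC0 hL0]
  set K := C * lam + C * (η * lam + 1 / (4 * η)) with hK
  have hK0 : 0 ≤ K := by positivity
  refine ⟨K.toNNReal, fun x => ?_⟩
  set V := hawkesLyapunov a b c (N + 1) with hV
  have hV0 := hawkesLyapunov_nonneg a b c (N + 1) (stateToReal x)
  set m := hawkesIntensity a b c lam x with hm
  rw [lintegral_hawkesKernel]
  have hflow : V (hawkesFlow a b c (stateToReal x)) ≤ V (stateToReal x) / 4 :=
    hawkesLyapunov_hawkesFlow_le (hN _ (Nat.cast_nonneg _))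
  have hpt : ∀ l : ℕ, V (stateToReal (l, x.1, x.2.1)) ≤
      V (stateToReal x) / 4 + C * lam + C * |(l : ℝ) - m| := fun l => by
    have h1 := hawkesLyapunov_le_add a b c (N + 1) (stateToReal (l, x.1, x.2.1))
      (hawkesFlow a b c (stateToReal x))
    have h2 := mul_le_mul_of_nonneg_left (l1Norm_next_sub_hawkesFlow_le hlam a b c x l) hC0
    rw [← hC, ← hV] at h1
    linarith
  calc _ ≤ ∫⁻ l : ℕ, ENNReal.ofReal (V (stateToReal x) / 4 + C * lam + C * |(l : ℝ) - m|)
        ∂poissonMeasure m := lintegral_mono fun l => ENNReal.ofReal_le_ofReal (hpt l)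
    _ ≤ ENNReal.ofReal (V (stateToReal x) / 4 + C * lam + C * (η * m + 1 / (4 * η))) :=
      lintegral_ofReal_abs_sub_poissonMeasure_le m (by positivity) hC0 hη0
    _ ≤ ENNReal.ofReal (2⁻¹ * V (stateToReal x) + K) := by
      refine ENNReal.ofReal_le_ofReal ?_
      have h1 : C * (η * m) ≤ C * (η * (L * V (stateToReal x) + lam)) := by
        gcongr
        exact (hawkesIntensity_le hlam a b c x).trans
          (by gcongr; exact l1Norm_le_hawkesLyapunov a b c N _)
      have h2 : C * (η * L) * V (stateToReal x) ≤ 1 / 4 * V (stateToReal x) := by gcongr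
      rw [hK]
      linarith
    _ = _ := by
      rw [ENNReal.ofReal_add (by positivity) hK0, ENNReal.ofReal_mul (by positivity)]
      congr 2
      rw [← ENNReal.ofReal_coe_nnreal]; simp

/-! ### Reaching the origin -/

lemma exp_neg_le_hawkesKernel_zero {a b c lam M : ℝ} {x : ℕ × ℕ × ℕ}
    (h : (hawkesIntensity a b c lam x : ℝ) ≤ M) :
    ENNReal.ofReal (Real.exp (-M)) ≤ hawkesKernel a b c lam x {(0, x.1, x.2.1)} := by
  change _ ≤ ((poissonMeasure (hawkesIntensity a b c lam x)).map
    (fun l : ℕ => (l, x.1, x.2.1))) {(0, x.1, x.2.1)}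
  rw [Measure.map_apply .of_discrete (measurableSet_singleton _)]
  have e : (fun l : ℕ => (l, x.1, x.2.1)) ⁻¹' {(0, x.1, x.2.1)} = {0} := by ext; simp
  rw [e, poissonMeasure_singleton]
  refine ENNReal.ofReal_le_ofReal ?_
  simpa using h

/-- From a state of size at most `R`, three successive zeros lead to the origin. -/
lemma le_hawkesKernel_pow_three_zero {lam : ℝ} (hlam : 0 < lam) (a b c : ℝ) {R : ℝ}
    {x : ℕ × ℕ × ℕ} (hx : l1Norm (stateToReal x) ≤ R) :
    Real.exp (-((|a| + |b| + |c|) * R + lam)) ^ 3 ≤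
      ((hawkesKernel a b c lam ^ 3) x).real {(0, 0, 0)} := by
  set e := Real.exp (-((|a| + |b| + |c|) * R + lam)) with he
  have hM : ∀ y : ℕ × ℕ × ℕ, l1Norm (stateToReal y) ≤ l1Norm (stateToReal x) →
      ENNReal.ofReal e ≤ hawkesKernel a b c lam y {(0, y.1, y.2.1)} := fun y hy =>
    exp_neg_le_hawkesKernel_zero ((hawkesIntensity_le hlam a b c y).trans
      (by gcongr; exact hy.trans hx))
  obtain ⟨i, j, k⟩ := x
  have h1 := hM (i, j, k) le_rfl
  have h2 := hM (0, i, j) (by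
    simp only [l1Norm_stateToReal]; push_cast
    linarith [k.cast_nonneg (α := ℝ)])
  have h3 := hM (0, 0, i) (by
    simp only [l1Norm_stateToReal]; push_cast
    linarith [k.cast_nonneg (α := ℝ), j.cast_nonneg (α := ℝ)])
  have p2 := Kernel.mul_le_pow_succ_apply (κ := hawkesKernel a b c lam) 1
    (0, i, j) (0, 0, i) (0, 0, 0)
  have p3 := Kernel.mul_le_pow_succ_apply (κ := hawkesKernel a b c lam) 2
    (i, j, k) (0, i, j) (0, 0, 0)
  rw [pow_one] at p2
  have : ENNReal.ofReal (e ^ 3) ≤ (hawkesKernel a b c lam ^ 3) (i, j, k) {(0, 0, 0)} := by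
    rw [ENNReal.ofReal_pow (Real.exp_nonneg _), pow_succ', pow_two]
    exact (mul_le_mul' h1 ((mul_le_mul' h2 h3).trans p2)).trans p3
  rw [measureReal_def]
  exact (ENNReal.ofReal_le_iff_le_toReal (measure_ne_top _ _)).1 this

theorem theorem2 (a b c lam : ℝ) (hlam : 0 < lam) (hb : b < 0) (hc : c < 0)
    (hdisc : a ^ 2 * b ^ 2 + 4 * b ^ 3 - 4 * a ^ 3 * c - 18 * a * b * c - 27 * c ^ 2 < 0) :
    IsGeometricallyErgodic (hawkesKernel a b c lam) := by
  obtain ⟨N, hN⟩ := exists_iterate_hawkesFlow_eq_zero hb hc hdisc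
  obtain ⟨K, hK⟩ := exists_drift hlam hN
  refine isGeometricallyErgodic_of_drift (k := 3) .of_discrete
    (inv_lt_one_of_one_lt₀ one_lt_two) hK (0, 0, 0) three_ne_zero fun R =>
    ⟨Real.exp (-((|a| + |b| + |c|) * R + lam)) ^ 3, by positivity, fun x hx =>
      le_hawkesKernel_pow_three_zero hlam a b c ?_⟩
  exact (l1Norm_le_hawkesLyapunov a b c N _).trans ((Real.le_coe_toNNReal _).trans hx)
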